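/- **Setting.** A search problem on inputs of length $N$ is a relation $R\subseteq\mathcal X\times\mathcal Y$ with $\mathcal X\subseteq\{0,1\}^N$. A quantum query algorithm with $q$ queries starts in a computational basis state, applies input-independent unitaries interleaved with $q$ uses of the oracle $U_X|i\rangle|j\rangle=|i\rangle|j\oplus X_i\rangle$ (acting as the identity on a finite-dimensional workspace), measures in the computational basis, and outputs a function of the outcome. It is *pseudo-deterministic* for $R$ if there is $f:\mathcal X\to\mathcal Y$ such that, for all $X\in\mathcal X$, $(X,f(X))\in R$ and the algorithm outputs $f(X)$ on input $X$ with probability at least $2/3$. $\mathsf{psQ}(R)$ is the minimum number of queries of a pseudo-deterministic quantum algorithm for $R$. $\mathsf R(R)$ is the minimum, over probability distributions on decision trees that on each $X\in\mathcal X$ output a solution with probability at least $2/3$, of the worst-case number of queries. For $1\le m\le N$, the problem $\mathrm{AOES}_m$ (Avoid One Encrypted String) on inputs of length $N$ is the following: the input consists of $m$ blocks $X_1,\dots,X_m\in\{0,1\}^{\lfloor N/m\rfloor}$ (followed by $N \bmod m$ irrelevant padding bits if $m$ does not divide $N$); with $b_i$ the exclusive or of all bits of $X_i$, the goal is to output a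 string $x\in\{0,1\}^m$ with $x\ne b$. **Theorem.** 1. There is an absolute constant $c>0$ such that for all $N$ and all $1\le m\le N$, every pseudo-deterministic quantum algorithm for $\mathrm{AOES}_m$ on inputs of length $N$ makes at least $c\,N/m^2$ queries. 2. There is an absolute constant $C$ such that $\mathsf R(\mathrm{AOES}_m)\le C$ for all $N$ and all $2\le m\le N$. 3. Consequently, for every constant $m\ge 2$, on inputs of length $N\ge m$, $\mathsf R(\mathrm{AOES}_m)=O(1)$ and $\mathsf{psQ}(\mathrm{AOES}_m)=\Omega(N)$. In particular there is a search problem, with inputs of every length $N$, whose randomized query complexity is $O(1)$ and whose pseudo-deterministic quantum query complexity is $\Omega(N)$ as $N\to\infty$. -/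

import Mathlib

/-- A search problem on inputs of length `N`, with solutions in `Y`: a set of admissible inputs in
`{0,1}^N` and a relation saying which outputs solve an admissible input. -/
structure SearchProblem (N : ℕ) (Y : Type*) where
  domain : Set (Fin N → Bool)
  rel : domain → Y → Prop

/-! ### Classical randomized query algorithms -/

/-- Deterministic query algorithms: decision trees. `query i t₀ t₁` asks for the bit `X i` and
continues with `t₀` if it is `0` and with `t₁` if it is `1`. -/
inductive DecisionTree (N : ℕ) (Y : Type*) where
  | leaf (y : Y) : DecisionTree N Y
  | query (i : Fin N) (t₀ t₁ : DecisionTree N Y) : DecisionTree N Y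

namespace DecisionTree

/-- The output on input `X`. -/
def eval {N : ℕ} {Y : Type*} (X : Fin N → Bool) : DecisionTree N Y → Y
  | leaf y => y
  | query i t₀ t₁ => if X i then t₁.eval X else t₀.eval X

/-- The worst-case number of queries. -/
def depth {N : ℕ} {Y : Type*} : DecisionTree N Y → ℕ
  | leaf _ => 0
  | query _ t₀ t₁ => max t₀.depth t₁.depth + 1

end DecisionTree

/-- A randomized query algorithm: a probability distribution over deterministic ones. -/
abbrev RandomizedQueryAlgorithm (N : ℕ) (Y : Type*) := PMF (DecisionTree N Y)

namespace RandomizedQueryAlgorithm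

/-- The algorithm never makes more than `q` queries. -/
def MakesAtMost {N : ℕ} {Y : Type*} (A : RandomizedQueryAlgorithm N Y) (q : ℕ) : Prop :=
  ∀ T ∈ A.support, T.depth ≤ q

/-- On every admissible input, the output is a solution with probability at least `2/3`. -/
def Solves {N : ℕ} {Y : Type*} (A : RandomizedQueryAlgorithm N Y) (R : SearchProblem N Y) : Prop :=
  ∀ X : R.domain, 2 / 3 ≤ A.toOuterMeasure {T | R.rel X (T.eval X.1)}

end RandomizedQueryAlgorithm

/-- The bounded-error randomized query complexity of `R`. -/
noncomputable def randomizedQueryComplexity {N : ℕ} {Y : Type*} (R : SearchProblem N Y) : ℕ∞ :=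
  ⨅ (q : ℕ) (_ : ∃ A : RandomizedQueryAlgorithm N Y, A.MakesAtMost q ∧ A.Solves R), (q : ℕ∞)

/-! ### Quantum query algorithms -/

/-- The labels `(i, j, w)` of the computational basis of the state space: `i` is the content of the
index register, `j` that of the one-qubit answer register, `w` that of the workspace. -/
abbrev QBasis (N d : ℕ) := Fin N × Bool × Fin d

/-- The oracle unitary `U_X`, with `U_X |i, j, w⟩ = |i, j ⊕ X i, w⟩`. -/
def oracle {N : ℕ} (d : ℕ) (X : Fin N → Bool) : Matrix (QBasis N d) (QBasis N d) ℂ :=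
  Matrix.of fun s t => if s = (t.1, Bool.xor t.2.1 (X t.1), t.2.2) then 1 else 0

/-- A quantum query algorithm on inputs of length `N` with outputs in `Y`: starting in a basis
state, it applies the unitaries `V 0, …, V queries` with one oracle call between each two
consecutive ones, measures in the computational basis, and computes its output from the outcome.
(The unitaries `V k` with `k > queries` are not used.) -/
structure QuantumQueryAlgorithm (N : ℕ) (Y : Type*) where
  queries : ℕ
  workDim : ℕ
  start : QBasis N workDim
  V : ℕ → Matrix.unitaryGroup (QBasis N workDim) ℂ
  out : QBasis N workDim → Y

namespace QuantumQueryAlgorithm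

/-- The state on input `X` after `k` oracle calls (and the unitary `V k`). -/
noncomputable def state {N : ℕ} {Y : Type*} (A : QuantumQueryAlgorithm N Y) (X : Fin N → Bool) :
    ℕ → QBasis N A.workDim → ℂ
  | 0 => Matrix.mulVec (A.V 0).1 (Pi.single A.start 1)
  | k + 1 => Matrix.mulVec (A.V (k + 1)).1 (Matrix.mulVec (oracle A.workDim X) (A.state X k))

open Classical in
/-- The probability that the algorithm outputs `y` on input `X`. -/
noncomputable def prob {N : ℕ} {Y : Type*} (A : QuantumQueryAlgorithm N Y) (X : Fin N → Bool)
    (y : Y) : ℝ :=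
  ∑ s : QBasis N A.workDim, if A.out s = y then ‖A.state X A.queries s‖ ^ 2 else 0

/-- `A` is a pseudo-deterministic algorithm for `R`: on every admissible input `X` it outputs a
canonical solution `f X` with probability at least `2/3`. -/
def IsPseudoDeterministicFor {N : ℕ} {Y : Type*} (A : QuantumQueryAlgorithm N Y)
    (R : SearchProblem N Y) : Prop :=
  ∃ f : R.domain → Y, ∀ X : R.domain, R.rel X (f X) ∧ 2 / 3 ≤ A.prob X.1 (f X)

end QuantumQueryAlgorithm

/-- The pseudo-deterministic bounded-error quantum query complexity of `R`. -/
noncomputable def psQ {N : ℕ} {Y : Type*} (R : SearchProblem N Y) : ℕ∞ :=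
  ⨅ (A : QuantumQueryAlgorithm N Y) (_ : A.IsPseudoDeterministicFor R), (A.queries : ℕ∞)

/-! ### Avoid One Encrypted String -/

/-- The exclusive or of all bits of a string. -/
def xorBits {n : ℕ} (x : Fin n → Bool) : Bool :=
  (List.ofFn x).foldr Bool.xor false

/-- The position in `X` of the `j`-th bit of the `i`-th block. -/
def blockIndex {N m : ℕ} (i : Fin m) (j : Fin (N / m)) : Fin N :=
  ⟨i * (N / m) + j, by
    have h1 : (i : ℕ) * (N / m) + j < (i + 1) * (N / m) := by
      rw [Nat.add_mul, Nat.one_mul]; exact Nat.add_lt_add_left j.2 _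
    exact lt_of_lt_of_le h1 ((Nat.mul_le_mul_right _ i.2).trans (Nat.mul_div_le N m))⟩

/-- The encrypted string `b`: bit `i` is the exclusive or of the `i`-th block of `X`. -/
def encryptedString {N : ℕ} (m : ℕ) (X : Fin N → Bool) : Fin m → Bool :=
  fun i => xorBits fun j : Fin (N / m) => X (blockIndex i j)

/-- The problem `AOES_m` on inputs of length `N`. The input consists of `m` consecutive blocks of
length `N / m`; the goal is to output an `m`-bit string other than the encrypted one. If `m` does
not divide `N`, the last `N % m` bits of the input are padding and play no role. -/
def AOES (N m : ℕ) : SearchProblem N (Fin m → Bool) where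
  domain := Set.univ
  rel X x := x ≠ encryptedString m X.1

/-! The lower bound is by the polynomial method. After `q` queries each probability `p_y(X)` of
output `y` has degree at most `2q` (`prob_mem_lowDegree`), so `p_y ^ (m+1)` has degree at most
`2q(m+1)`. Suppose this is below the block length. Any set of so few coordinates misses a bit of
every block, so the encrypted string `b(X)` is uncorrelated with `p_y ^ (m+1)`
(`two_pow_mul_sum_encryptedString_eq`). Summing over `y`, the average over `X` of `2^m * p_{b(X)}(X)
^ (m+1)` equals that of `∑ y, p_y(X) ^ (m+1)`. But for every `X` the canonical answer, which differs
from `b(X)`, has probability at least `2/3`, so `p_{b(X)}(X) ≤ 1/3`. The first quantity is then at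
most `2^m / 3^(m+1)`, strictly less than `(2/3)^(m+1)`, which bounds the second from below: a
contradiction. Hence `N / m ≤ 2q(m+1)`. For the randomized bound, a blind uniform guess suffices. -/

/-! ### Functions of low degree -/

/-- The complex-valued functions on `{0,1}^N` of degree at most `d`: the linear combinations of
functions that depend on at most `d` coordinates. -/
def lowDegree (N d : ℕ) : Submodule ℂ ((Fin N → Bool) → ℂ) :=
  Submodule.span ℂ {h | ∃ S : Finset (Fin N), S.card ≤ d ∧ DependsOn h (S : Set (Fin N))}

namespace lowDegree

variable {N d e : ℕ} {g h : (Fin N → Bool) → ℂ}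

theorem of_dependsOn {S : Finset (Fin N)} (hS : S.card ≤ d)
    (hg : DependsOn g (S : Set (Fin N))) : g ∈ lowDegree N d :=
  Submodule.subset_span ⟨S, hS, hg⟩

theorem const_mem (c : ℂ) : (fun _ => c) ∈ lowDegree N d :=
  of_dependsOn (S := ∅) (by simp) fun _ _ _ => rfl

theorem apply_mem (φ : Bool → ℂ) (i : Fin N) : (fun X => φ (X i)) ∈ lowDegree N 1 :=
  of_dependsOn (S := {i}) (by simp) fun x y hxy => by simp [hxy i (by simp)]

theorem mul_mem (hg : g ∈ lowDegree N d) (hh : h ∈ lowDegree N e) :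
    g * h ∈ lowDegree N (d + e) := by
  have key := Submodule.mul_mem_mul hg hh
  rw [lowDegree, lowDegree, Submodule.span_mul_span] at key
  refine Submodule.span_mono ?_ key
  rintro _ ⟨a, ⟨S, hS, ha⟩, b, ⟨T, hT, hb⟩, rfl⟩
  refine ⟨S ∪ T, (Finset.card_union_le _ _).trans (add_le_add hS hT), fun x y hxy => ?_⟩
  have h1 : a x = a y := ha fun i hi => hxy i (by simp at hi ⊢; exact Or.inl hi)
  have h2 : b x = b y := hb fun i hi => hxy i (by simp at hi ⊢; exact Or.inr hi)
  simp [h1, h2]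

theorem pow_mem (hg : g ∈ lowDegree N d) (t : ℕ) : g ^ t ∈ lowDegree N (d * t) := by
  induction t with
  | zero => exact const_mem 1
  | succ t ih => rw [pow_succ, Nat.mul_succ]; exact mul_mem ih hg

theorem star_mem (hg : g ∈ lowDegree N d) : star g ∈ lowDegree N d := by
  induction hg using Submodule.span_induction with
  | mem a ha =>
    obtain ⟨S, hS, ha⟩ := ha
    exact of_dependsOn hS fun x y hxy => by simp [ha hxy]
  | zero => simp
  | add a b _ _ iha ihb => rw [star_add]; exact add_mem iha ihb
  | smul c a _ iha => rw [star_smul]; exact Submodule.smul_mem _ _ iha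

end lowDegree

/-! ### Quantum query algorithms -/

theorem oracle_mulVec {N d : ℕ} (X : Fin N → Bool) (v : QBasis N d → ℂ) (s : QBasis N d) :
    Matrix.mulVec (oracle d X) v s = v (s.1, Bool.xor s.2.1 (X s.1), s.2.2) := by
  rw [Matrix.mulVec, dotProduct, Finset.sum_eq_single (s.1, Bool.xor s.2.1 (X s.1), s.2.2)]
  · simp [oracle]
  · intro t _ ht
    have : s ≠ (t.1, Bool.xor t.2.1 (X t.1), t.2.2) := by
      rintro rfl
      exact ht (by simp)
    simp [oracle, this]
  · simp

theorem sum_norm_sq_oracle_mulVec {N d : ℕ} (X : Fin N → Bool) (v : QBasis N d → ℂ) :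
    ∑ s, ‖Matrix.mulVec (oracle d X) v s‖ ^ 2 = ∑ s, ‖v s‖ ^ 2 := by
  simp only [oracle_mulVec]
  have hinv : Function.Involutive
      (fun s : QBasis N d => ((s.1, Bool.xor s.2.1 (X s.1), s.2.2) : QBasis N d)) := by
    rintro ⟨i, j, w⟩; simp
  exact Equiv.sum_comp hinv.toPerm fun s => ‖v s‖ ^ 2

theorem sum_norm_sq_unitary_mulVec {ι : Type*} [Fintype ι] [DecidableEq ι]
    (U : Matrix.unitaryGroup ι ℂ) (v : ι → ℂ) :
    ∑ s, ‖Matrix.mulVec U.1 v s‖ ^ 2 = ∑ s, ‖v s‖ ^ 2 := by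
  have hnorm (w : ι → ℂ) : ((∑ s, ‖w s‖ ^ 2 : ℝ) : ℂ) = dotProduct (star w) w := by
    simp [dotProduct, ← Complex.conj_mul']
  have hU : U.1.conjTranspose * U.1 = 1 := Matrix.UnitaryGroup.star_mul_self U
  apply Complex.ofReal_injective
  rw [hnorm, hnorm, Matrix.star_mulVec, Matrix.dotProduct_mulVec, Matrix.vecMul_vecMul, hU,
    Matrix.vecMul_one]

namespace QuantumQueryAlgorithm

variable {N : ℕ} {Y : Type*} (A : QuantumQueryAlgorithm N Y)

theorem sum_norm_sq_state (X : Fin N → Bool) (k : ℕ) : ∑ s, ‖A.state X k s‖ ^ 2 = 1 := by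
  induction k with
  | zero =>
    rw [state, sum_norm_sq_unitary_mulVec, Finset.sum_eq_single A.start]
    · simp
    · intro s _ hs; simp [hs]
    · simp
  | succ k ih => rw [state, sum_norm_sq_unitary_mulVec, sum_norm_sq_oracle_mulVec, ih]

theorem prob_nonneg (X : Fin N → Bool) (y : Y) : 0 ≤ A.prob X y :=
  Finset.sum_nonneg fun s _ => by split_ifs <;> positivity

theorem prob_add_prob_le_one (X : Fin N → Bool) {y z : Y} (hyz : y ≠ z) :
    A.prob X y + A.prob X z ≤ 1 := by
  rw [← A.sum_norm_sq_state X A.queries, prob, prob, ← Finset.sum_add_distrib]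
  refine Finset.sum_le_sum fun s _ => ?_
  have := sq_nonneg ‖A.state X A.queries s‖
  split_ifs with h1 h2
  · exact absurd (h1.symm.trans h2) hyz
  all_goals linarith

/-- The amplitudes after `k` oracle calls have degree at most `k` in the input. -/
theorem state_mem_lowDegree (k : ℕ) (s : QBasis N A.workDim) :
    (fun X => A.state X k s) ∈ lowDegree N k := by
  induction k generalizing s with
  | zero => exact lowDegree.const_mem _
  | succ k ih =>
    have hstep (t : QBasis N A.workDim) :
        (fun X => Matrix.mulVec (oracle A.workDim X) (A.state X k) t) ∈ lowDegree N (k + 1) := by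
      -- With `a` the amplitude before the query, `a(i, j ⊕ X i, w) = (1 - X i) a(i, j, w) + X i
      -- a(i, ¬j, w)`, so a query raises the degree by at most one.
      have h1 := lowDegree.mul_mem (ih (t.1, t.2.1, t.2.2))
        (lowDegree.apply_mem (fun b => if b then 0 else 1) t.1)
      have h2 := lowDegree.mul_mem (ih (t.1, !t.2.1, t.2.2))
        (lowDegree.apply_mem (fun b => if b then 1 else 0) t.1)
      convert add_mem h1 h2 using 1
      funext X
      rw [oracle_mulVec]
      cases hX : X t.1 <;> simp [hX]
    have hsum : (fun X => A.state X (k + 1) s) = ∑ t, (A.V (k + 1)).1 s t •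
        fun X => Matrix.mulVec (oracle A.workDim X) (A.state X k) t := by
      funext X
      simp [state, Matrix.mulVec, dotProduct]
    rw [hsum]
    exact Submodule.sum_mem _ fun t _ => Submodule.smul_mem _ _ (hstep t)

/-- The output probabilities have degree at most twice the number of queries in the input. -/
theorem prob_mem_lowDegree (y : Y) :
    (fun X => (A.prob X y : ℂ)) ∈ lowDegree N (2 * A.queries) := by
  classical
  have hsum : (fun X => (A.prob X y : ℂ)) =
      ∑ s, if A.out s = y then
        (star fun X => A.state X A.queries s) * (fun X => A.state X A.queries s) else 0 := by
    funext X
    rw [prob, Finset.sum_apply, Complex.ofReal_sum]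
    refine Finset.sum_congr rfl fun s _ => ?_
    split_ifs <;> simp [← Complex.conj_mul']
  rw [hsum, two_mul]
  refine Submodule.sum_mem _ fun s _ => ?_
  split_ifs
  · exact lowDegree.mul_mem (lowDegree.star_mem (A.state_mem_lowDegree _ s))
      (A.state_mem_lowDegree _ s)
  · exact zero_mem _

end QuantumQueryAlgorithm

/-! ### Block parities -/

theorem xorBits_succ {n : ℕ} (x : Fin (n + 1) → Bool) :
    xorBits x = Bool.xor (x 0) (xorBits fun j => x j.succ) := by
  simp [xorBits, List.ofFn_succ]

theorem xorBits_xor {n : ℕ} (x y : Fin n → Bool) :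
    xorBits (fun j => Bool.xor (x j) (y j)) = Bool.xor (xorBits x) (xorBits y) := by
  induction n with
  | zero => simp [xorBits]
  | succ n ih => simp only [xorBits_succ, ih, Bool.xor_assoc, Bool.xor_left_comm]

theorem xorBits_false {n : ℕ} : xorBits (fun _ : Fin n => false) = false := by
  induction n with
  | zero => simp [xorBits]
  | succ n ih => simp [xorBits_succ, ih]

theorem xorBits_single {n : ℕ} (k : Fin n) (z : Bool) :
    xorBits (fun j => decide (j = k) && z) = z := by
  induction n with
  | zero => exact k.elim0
  | succ n ih =>
    rw [xorBits_succ]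
    cases k using Fin.cases with
    | zero => simp [Fin.succ_ne_zero, xorBits_false]
    | succ k => simp [(Fin.succ_ne_zero k).symm, ih]

theorem blockIndex_inj {N m : ℕ} {i i' : Fin m} {j j' : Fin (N / m)}
    (h : blockIndex i j = blockIndex i' j') : i = i' ∧ j = j' := by
  have hpos : 0 < N / m := j.pos
  have h' : (i : ℕ) * (N / m) + j = i' * (N / m) + j' := congrArg Fin.val h
  have hj := congrArg (· % (N / m)) h'
  have hi := congrArg (· / (N / m)) h'
  simp only [Nat.mul_add_mod', Nat.mod_eq_of_lt j.2, Nat.mod_eq_of_lt j'.2] at hj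
  simp only [mul_comm _ (N / m), Nat.mul_add_div hpos, Nat.div_eq_of_lt j.2,
    Nat.div_eq_of_lt j'.2, add_zero] at hi
  exact ⟨Fin.ext hi, Fin.ext hj⟩

/-- Flip the bit number `j i` of block `i` for each `i` with `z i = 1`. -/
def flipBlocks {N m : ℕ} (j : Fin m → Fin (N / m)) (z : Fin m → Bool) (X : Fin N → Bool) :
    Fin N → Bool :=
  fun p => Bool.xor (X p) (decide (∃ i, blockIndex i (j i) = p ∧ z i = true))

section flipBlocks

variable {N m : ℕ} (j : Fin m → Fin (N / m)) (z : Fin m → Bool)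

theorem flipBlocks_involutive : Function.Involutive (flipBlocks j z) := by
  intro X; funext p; simp [flipBlocks]

/-- Parity is additive, and since blocks are disjoint the flip mask meets block `i` only in bit `j
i`, with parity `z i`. -/
theorem encryptedString_flipBlocks (X : Fin N → Bool) :
    encryptedString m (flipBlocks j z X) =
      fun i => Bool.xor (encryptedString m X i) (z i) := by
  funext i
  have hmask (k : Fin (N / m)) :
      decide (∃ i', blockIndex i' (j i') = blockIndex i k ∧ z i' = true) =
        (decide (k = j i) && z i) := by
    rw [Bool.eq_iff_iff]
    simp only [decide_eq_true_eq, Bool.and_eq_true]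
    constructor
    · rintro ⟨i', h, hz⟩
      obtain ⟨rfl, hk⟩ := blockIndex_inj h
      exact ⟨hk.symm, hz⟩
    · rintro ⟨rfl, hz⟩
      exact ⟨i, rfl, hz⟩
  simp only [encryptedString, flipBlocks, xorBits_xor, hmask, xorBits_single]

theorem flipBlocks_apply_of_notMem {S : Finset (Fin N)} (hj : ∀ i, blockIndex i (j i) ∉ S)
    (X : Fin N → Bool) {p : Fin N} (hp : p ∈ S) : flipBlocks j z X p = X p := by
  have : ¬ ∃ i, blockIndex i (j i) = p ∧ z i = true := by
    rintro ⟨i, rfl, -⟩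
    exact hj i hp
  simp [flipBlocks, this]

end flipBlocks

theorem exists_blockIndex_notMem {N m : ℕ} {S : Finset (Fin N)} (hS : S.card < N / m)
    (i : Fin m) : ∃ j : Fin (N / m), blockIndex i j ∉ S := by
  by_contra! h
  have hle := Finset.card_le_card_of_injOn (s := Finset.univ) (t := S) (blockIndex i)
    (fun j _ => h j) fun j _ j' _ hjj' => (blockIndex_inj hjj').2
  simp at hle
  omega

/-- The encrypted string is uniform and uncorrelated with each function of degree less than the
block length. -/
theorem two_pow_mul_sum_encryptedString_eq {N m d : ℕ} (hd : d < N / m)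
    {g : (Fin N → Bool) → ℂ} (hg : g ∈ lowDegree N d) (y : Fin m → Bool) :
    2 ^ m * ∑ X, (if encryptedString m X = y then g X else 0) = ∑ X, g X := by
  induction hg using Submodule.span_induction with
  | mem g hg =>
    obtain ⟨S, hS, hg⟩ := hg
    choose j hj using fun i : Fin m => exists_blockIndex_notMem (hS.trans_lt hd) i
    -- The flipped bits avoid `S`, so the substitution fixes `g` and shifts the encrypted string by
    -- `z`. For each `X` exactly one `z` meets the resulting condition, so summing over all `2 ^ m`
    -- values of `z` recovers the full sum.
    have hflip (z : Fin m → Bool) :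
        ∑ X, (if encryptedString m X = y then g X else 0) =
          ∑ X, if z = (fun i => Bool.xor (encryptedString m X i) (y i)) then g X else 0 := by
      rw [← Equiv.sum_comp (flipBlocks_involutive j z).toPerm]
      refine Finset.sum_congr rfl fun X _ => ?_
      have hgX : g (flipBlocks j z X) = g X :=
        hg fun p hp => flipBlocks_apply_of_notMem j z hj X hp
      have hiff : (fun i => Bool.xor (encryptedString m X i) (z i)) = y ↔
          z = fun i => Bool.xor (encryptedString m X i) (y i) := by
        constructor <;> rintro rfl <;> simp
      simp only [Function.Involutive.coe_toPerm, encryptedString_flipBlocks, hgX, hiff]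
    calc 2 ^ m * ∑ X, (if encryptedString m X = y then g X else 0)
        = ∑ _z : Fin m → Bool, ∑ X, (if encryptedString m X = y then g X else 0) := by simp
      _ = ∑ z : Fin m → Bool, ∑ X,
            if z = (fun i => Bool.xor (encryptedString m X i) (y i)) then g X else 0 :=
          Finset.sum_congr rfl fun z _ => hflip z
      _ = ∑ X, g X := by rw [Finset.sum_comm]; simp
  | zero => simp
  | add a b _ _ iha ihb =>
    rw [← Finset.sum_filter] at iha ihb ⊢
    simp only [Pi.add_apply, Finset.sum_add_distrib, mul_add, iha, ihb]
  | smul c a _ iha =>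
    rw [← Finset.sum_filter] at iha ⊢
    simp only [Pi.smul_apply, smul_eq_mul, ← Finset.mul_sum, ← iha]
    ring

/-! ### Complexity of `AOES` -/

theorem QuantumQueryAlgorithm.IsPseudoDeterministicFor.div_le_queries {N m : ℕ}
    {A : QuantumQueryAlgorithm N (Fin m → Bool)} (hA : A.IsPseudoDeterministicFor (AOES N m)) :
    N / m ≤ 2 * A.queries * (m + 1) := by
  by_contra! hlt
  obtain ⟨f, hf⟩ := hA
  -- `m + 1` is the least exponent `t` with `2 ^ m * (1/3) ^ t < (2/3) ^ t`.
  have hbal (y : Fin m → Bool) :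
      2 ^ m * ∑ X, (if encryptedString m X = y then A.prob X y ^ (m + 1) else 0) =
        ∑ X, A.prob X y ^ (m + 1) := by
    have := two_pow_mul_sum_encryptedString_eq hlt
      (lowDegree.pow_mem (A.prob_mem_lowDegree y) (m + 1)) y
    simp only [Pi.pow_apply] at this
    apply Complex.ofReal_injective
    push_cast [apply_ite]
    exact this
  have hsum : ∑ X, 2 ^ m * A.prob X (encryptedString m X) ^ (m + 1) =
      ∑ X, ∑ y, A.prob X y ^ (m + 1) := by
    rw [Finset.sum_comm, ← Finset.sum_congr rfl fun y _ => hbal y, ← Finset.mul_sum,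
      ← Finset.mul_sum, Finset.sum_comm]
    simp
  refine hsum.not_lt (Finset.sum_lt_sum_of_nonempty Finset.univ_nonempty fun X _ => ?_)
  obtain ⟨hne, hprob⟩ := hf ⟨X, Set.mem_univ X⟩
  set y := f ⟨X, Set.mem_univ X⟩
  have hne' : y ≠ encryptedString m X := hne
  have hle : A.prob X (encryptedString m X) ≤ 1 / 3 := by
    have := A.prob_add_prob_le_one X hne'
    linarith
  calc 2 ^ m * A.prob X (encryptedString m X) ^ (m + 1)
      ≤ 2 ^ m * (1 / 3) ^ (m + 1) := by
        gcongr
        exact A.prob_nonneg _ _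
    _ < 2 ^ (m + 1) * (1 / 3) ^ (m + 1) := by
        gcongr <;> norm_num
    _ = (2 / 3) ^ (m + 1) := by rw [← mul_pow]; norm_num
    _ ≤ A.prob X y ^ (m + 1) := by gcongr
    _ ≤ ∑ y, A.prob X y ^ (m + 1) :=
        Finset.single_le_sum (f := fun y => A.prob X y ^ (m + 1))
          (fun y _ => pow_nonneg (A.prob_nonneg X y) _) (Finset.mem_univ y)

theorem QuantumQueryAlgorithm.IsPseudoDeterministicFor.le_queries {N m : ℕ} (hm : 1 ≤ m)
    (hmN : m ≤ N) {A : QuantumQueryAlgorithm N (Fin m → Bool)}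
    (hA : A.IsPseudoDeterministicFor (AOES N m)) :
    1 / 8 * ((N : ℝ) / (m : ℝ) ^ 2) ≤ (A.queries : ℝ) := by
  have h1 := hA.div_le_queries
  have h2 : 1 ≤ N / m := (Nat.one_le_div_iff hm).2 hmN
  have h3 : N < m * (N / m + 1) := Nat.lt_mul_div_succ N hm
  have h4 : N ≤ 8 * A.queries * m ^ 2 := by
    calc N ≤ m * (N / m + 1) := h3.le
      -- Rounding down the block length costs a factor 2, as `N / m ≥ 1`; replacing `m + 1` by `2m`
      -- costs another.
      _ ≤ m * (2 * (N / m)) := by gcongr; omega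
      _ ≤ m * (2 * (2 * A.queries * (m + 1))) := by gcongr
      _ ≤ m * (2 * (2 * A.queries * (m + m))) := by gcongr
      _ = 8 * A.queries * m ^ 2 := by ring
  have h5 : (N : ℝ) ≤ 8 * A.queries * (m : ℝ) ^ 2 := by exact_mod_cast h4
  have h6 : (N : ℝ) / (m : ℝ) ^ 2 ≤ 8 * A.queries :=
    div_le_of_le_mul₀ (by positivity) (by positivity) h5
  linarith

theorem ofReal_le_psQ_AOES {N m : ℕ} (hm : 1 ≤ m) (hmN : m ≤ N) :
    ENNReal.ofReal (1 / (8 * (m : ℝ) ^ 2) * N) ≤ ((psQ (AOES N m) : ℕ∞) : ENNReal) := by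
  set r : ℝ := 1 / (8 * (m : ℝ) ^ 2) * N with hr
  -- Query counts are integers, so the real bound may be rounded up and the infimum taken in `ℕ∞`.
  have hceil : ((⌈r⌉₊ : ℕ) : ℕ∞) ≤ psQ (AOES N m) := by
    refine le_iInf₂ fun A hA => ?_
    rw [Nat.cast_le, Nat.ceil_le]
    refine le_of_eq_of_le ?_ (hA.le_queries hm hmN)
    rw [hr]; ring
  calc ENNReal.ofReal r ≤ ENNReal.ofReal (⌈r⌉₊ : ℝ) := ENNReal.ofReal_le_ofReal (Nat.le_ceil r)
    _ = (((⌈r⌉₊ : ℕ) : ℕ∞) : ENNReal) := by simp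
    _ ≤ _ := ENat.toENNReal_le.2 hceil

/-- A uniformly random string solves `AOES` with probability `1 - 2⁻ᵐ`, without any query. -/
theorem randomizedQueryComplexity_AOES (N : ℕ) {m : ℕ} (hm : 2 ≤ m) :
    randomizedQueryComplexity (AOES N m) = 0 := by
  refine le_antisymm (iInf₂_le 0 ⟨(PMF.uniformOfFintype (Fin m → Bool)).map DecisionTree.leaf,
    fun T hT => ?_, fun X => ?_⟩) bot_le
  · rw [PMF.support_map] at hT
    obtain ⟨y, -, rfl⟩ := hT
    exact le_rfl
  · have hset : DecisionTree.leaf ⁻¹'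
        {T : DecisionTree N (Fin m → Bool) | (AOES N m).rel X (T.eval X.1)} =
          {encryptedString m X.1}ᶜ := by
      ext y; simp [AOES, DecisionTree.eval]
    have hcard : Fintype.card ({encryptedString m X.1}ᶜ : Set (Fin m → Bool)) = 2 ^ m - 1 := by
      rw [Fintype.card_compl_set]; simp
    -- Here `m ≥ 2` enters: the success probability is at least `3/4`, whereas `m = 1` would give
    -- only `1/2`.
    have h4 : 4 ≤ 2 ^ m := by simpa using Nat.pow_le_pow_right (n := 2) (by norm_num) hm
    rw [PMF.toOuterMeasure_map_apply, hset, PMF.toOuterMeasure_uniformOfFintype_apply, hcard,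
      ENNReal.le_div_iff_mul_le (by simp) (by simp), div_eq_mul_inv, mul_right_comm, ← div_eq_mul_inv,
      ENNReal.div_le_iff (by simp) (by simp)]
    have : 2 * 2 ^ m ≤ (2 ^ m - 1) * 3 := by omega
    simp only [Fintype.card_pi, Fintype.card_bool, Finset.prod_const, Finset.card_univ,
      Fintype.card_fin]
    exact_mod_cast this

/-- Any pseudo-deterministic quantum algorithm for `AOES_m` makes `Ω(N / m²)` queries, the randomized
query complexity of `AOES_m` is `O(1)`, so `AOES_m` with a constant `m` has randomized complexity
`O(1)` and pseudo-deterministic quantum complexity `Ω(N)`; in particular such a search problem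
exists. -/
theorem theorem6 :
    (∃ c : ℝ, 0 < c ∧ ∀ N m : ℕ, 1 ≤ m → m ≤ N →
      ∀ A : QuantumQueryAlgorithm N (Fin m → Bool), A.IsPseudoDeterministicFor (AOES N m) →
        c * ((N : ℝ) / (m : ℝ) ^ 2) ≤ (A.queries : ℝ)) ∧
    (∃ C : ℕ, ∀ N m : ℕ, 2 ≤ m → m ≤ N → randomizedQueryComplexity (AOES N m) ≤ (C : ℕ∞)) ∧
    (∀ m : ℕ, 2 ≤ m →
      (∃ C : ℕ, ∀ N : ℕ, m ≤ N → randomizedQueryComplexity (AOES N m) ≤ (C : ℕ∞)) ∧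
      (∃ c : ℝ, 0 < c ∧ ∀ N : ℕ, m ≤ N →
        ENNReal.ofReal (c * (N : ℝ)) ≤ ((psQ (AOES N m) : ℕ∞) : ENNReal))) ∧
    (∃ (Y : Type) (R : (N : ℕ) → SearchProblem N Y),
      (∃ C : ℕ, ∀ N : ℕ, randomizedQueryComplexity (R N) ≤ (C : ℕ∞)) ∧
      (∃ c : ℝ, 0 < c ∧ ∃ N₀ : ℕ, ∀ N : ℕ, N₀ ≤ N →
        ENNReal.ofReal (c * (N : ℝ)) ≤ ((psQ (R N) : ℕ∞) : ENNReal))) := by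
  refine ⟨⟨1 / 8, by norm_num, fun N m hm hmN A hA => hA.le_queries hm hmN⟩,
    ⟨0, fun N m hm _ => (randomizedQueryComplexity_AOES N hm).le⟩,
    fun m hm => ⟨⟨0, fun N _ => (randomizedQueryComplexity_AOES N hm).le⟩,
      1 / (8 * (m : ℝ) ^ 2), by positivity, fun N hmN => ofReal_le_psQ_AOES (by omega) hmN⟩,
    Fin 2 → Bool, fun N => AOES N 2,
    ⟨0, fun N => (randomizedQueryComplexity_AOES N le_rfl).le⟩,
    1 / (8 * ((2 : ℕ) : ℝ) ^ 2), by positivity, 2,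
    fun N hN => ofReal_le_psQ_AOES (by norm_num) hN⟩
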